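/- Let $d,r\ge 0$ be integers. Let $C(\mathbb{Z}^d;\mathbb{C}^r)$ be the space of all functions $u:\mathbb{Z}^d\to\mathbb{C}^r$ with the topology of coordinatewise convergence, and let $A$ be a closed linear subspace that is shift-invariant, that is, $W_iA=A$ for $1\le i\le d$, where $(W_iu)(k)=u(k-e_i)$. A vectorial pg-sequence with geometric index $\omega\in(\mathbb{C}\setminus\{0\})^d$ is a function of the form $k\mapsto \omega^k h(k)$, where $\omega^k=\omega_1^{k_1}\cdots\omega_d^{k_d}$ and $h=(h_1,\dots,h_r)$ is an $r$-tuple of polynomials in $\mathbb{C}[z_1,\dots,z_d]$. Then: (1) $A$ is the closed linear span of the vectorial pg-sequences that lie in $A$. (2) There is a finite set $\Omega\subset(\mathbb{C}\setminus\{0\})^d$ such that $A$ is the closed linear span of the vectorial pg-sequences in $A$ with geometric index in $\Omega$. (3) Let $L=\mathbb{C}[z_1^{\pm1},\dots,z_d^{\pm1}]$ and let $B=A^\perp\subseteq L^r$ be the annihilator module of $A$, that is, the $L$-submodule of all $p=(p_1,\dots,p_r)$, $p_t=\sum_k a_{t,k}z^k$, such that $\sum_{t=1}^r\sum_k a_{t,k}\,u(k)_t=0$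 for all $u\in A$. A submodule $Q\subsetneq L^r$ is $P$-primary if multiplication by each element of $L$ on $L^r/Q$ is either injective or nilpotent, and $P$ is the (prime) ideal of those elements of $L$ that act nilpotently. A primary decomposition of $B$ is an equality $B=Q_1\cap\dots\cap Q_s$ with $s\ge 0$, where $Q_i$ is $P_i$-primary and the $P_i$ are distinct (for $s=0$ the intersection is $L^r$). Then $B$ has a primary decomposition. Moreover, for every primary decomposition $B=Q_1\cap\dots\cap Q_s$, each $P_i$ has a root in $(\mathbb{C}\setminus\{0\})^d$ (a point at which all elements of $P_i$ vanish), and for every choice of roots $\omega(i)\in(\mathbb{C}\setminus\{0\})^d$ of $P_i$, $1\le i\le s$, the space $A$ is the closed linear span of the vectorial pg-sequences in $A$ with geometric indices in $\{\omega(1),\dots,\omega(s)\}$. -/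

import Mathlib

namespace ShiftSynthesis

/-- `C(ℤ^d; ℂ^r)`: all functions `ℤ^d → ℂ^r`. Its (product) topology is the topology of
coordinatewise convergence. -/
abbrev MultiSeq (d r : ℕ) : Type := (Fin d → ℤ) → Fin r → ℂ

/-- The forward shift operator `(W_i u)(k) = u(k - e_i)`. -/
def shift {d r : ℕ} (i : Fin d) : MultiSeq d r →ₗ[ℂ] MultiSeq d r where
  toFun u := fun k => u (k - Pi.single i 1)
  map_add' _ _ := rfl
  map_smul' _ _ := rfl

/-- `A` is (bilaterally) shift-invariant: `W_i A = A` for each `i`. -/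
def IsShiftInvariant {d r : ℕ} (A : Submodule ℂ (MultiSeq d r)) : Prop :=
  ∀ i : Fin d, A.map (shift i) = A

/-- The monomial value `ω^k = ω_1^{k_1} ⋯ ω_d^{k_d}` for `ω ∈ (ℂ \ {0})^d` and `k ∈ ℤ^d`. -/
noncomputable def monomialValue {d : ℕ} (ω : Fin d → ℂˣ) (k : Fin d → ℤ) : ℂ :=
  ∏ i, (ω i : ℂ) ^ (k i)

/-- The vectorial polynomially weighted geometric sequence `k ↦ ω^k h(k)`, with geometric index
`ω ∈ (ℂ \ {0})^d` and `h = (h_1, …, h_r)` a vector of polynomials in `d` variables. -/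
noncomputable def pgSeq {d r : ℕ} (ω : Fin d → ℂˣ) (h : Fin r → MvPolynomial (Fin d) ℂ) :
    MultiSeq d r :=
  fun k t => monomialValue ω k * MvPolynomial.eval (fun i => (k i : ℂ)) (h t)

/-- The closed linear span of the pg-sequences that lie in `A` and have geometric index in `Ω`. -/
noncomputable def closedPgSpan {d r : ℕ} (A : Submodule ℂ (MultiSeq d r))
    (Ω : Set (Fin d → ℂˣ)) : Submodule ℂ (MultiSeq d r) :=
  (Submodule.span ℂ
    {u : MultiSeq d r | u ∈ A ∧ ∃ ω ∈ Ω, ∃ h : Fin r → MvPolynomial (Fin d) ℂ,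
      u = pgSeq ω h}).topologicalClosure

/-- The ring of complex Laurent polynomials in `d` variables, as the group algebra of `ℤ^d`:
`∑ a_k z^k` is the finitely supported function `k ↦ a_k`. -/
abbrev Laurent (d : ℕ) : Type := AddMonoidAlgebra ℂ (Fin d → ℤ)

/-- The pairing `⟨∑ a_k z^k, u⟩ = ∑ a_k u_k` of a Laurent polynomial with a scalar multi-sequence. -/
noncomputable def scalarPairing {d : ℕ} (p : Laurent d) (u : (Fin d → ℤ) → ℂ) : ℂ :=
  p.coeff.sum fun k a => a * u k

/-- The pairing `⟨p, u⟩ = ∑_t ⟨p_t, u_t⟩` of vectors of Laurent polynomials with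
vector-valued multi-sequences. -/
noncomputable def pairing {d r : ℕ} (p : Fin r → Laurent d) (u : MultiSeq d r) : ℂ :=
  ∑ t, scalarPairing (p t) fun k => u k t

/-- The value `∑ a_k ω^k` of the Laurent polynomial `∑ a_k z^k` at `ω ∈ (ℂ \ {0})^d`. -/
noncomputable def laurentEval {d : ℕ} (ω : Fin d → ℂˣ) (p : Laurent d) : ℂ :=
  scalarPairing p (monomialValue ω)

/-- A shift-invariant space is invariant under translation by every element of `ℤ^d`. -/
theorem IsShiftInvariant.translate_mem {d r : ℕ} {A : Submodule ℂ (MultiSeq d r)}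
    (hA : IsShiftInvariant A) (m : Fin d → ℤ) :
    ∀ u ∈ A, (fun k => u (k + m) : MultiSeq d r) ∈ A := by
  have hpos : ∀ (i : Fin d), ∀ u ∈ A, (fun k => u (k + Pi.single i 1) : MultiSeq d r) ∈ A := by
    intro i u hu
    rw [← hA i] at hu
    obtain ⟨v, hv, rfl⟩ := hu
    simpa [shift] using hv
  have hneg : ∀ (i : Fin d), ∀ u ∈ A, (fun k => u (k + -Pi.single i 1) : MultiSeq d r) ∈ A := by
    intro i u hu
    have h : shift i u ∈ A := by
      have h' := Submodule.mem_map_of_mem (f := shift i) hu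
      rwa [hA i] at h'
    simpa [shift, sub_eq_add_neg] using h
  have hcomp : ∀ a b : Fin d → ℤ,
      (∀ u ∈ A, (fun k => u (k + a) : MultiSeq d r) ∈ A) →
      (∀ u ∈ A, (fun k => u (k + b) : MultiSeq d r) ∈ A) →
      ∀ u ∈ A, (fun k => u (k + (a + b)) : MultiSeq d r) ∈ A := by
    intro a b ha hb u hu
    have h := ha _ (hb u hu)
    simpa [add_assoc] using h
  have hsingle : ∀ (i : Fin d) (n : ℤ), ∀ u ∈ A,
      (fun k => u (k + Pi.single i n) : MultiSeq d r) ∈ A := by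
    intro i n
    induction n using Int.induction_on with
    | zero => intro u hu; simpa using hu
    | succ n ih =>
      rw [Pi.single_add]
      exact hcomp _ _ ih (hpos i)
    | pred n ih =>
      rw [Pi.single_sub, sub_eq_add_neg]
      exact hcomp _ _ ih (hneg i)
  rw [← Finset.univ_sum_single m]
  refine Finset.sum_induction _
    (fun a => ∀ u ∈ A, (fun k => u (k + a) : MultiSeq d r) ∈ A) hcomp ?_ ?_
  · intro u hu
    simpa using hu
  · intro i _
    exact hsingle i (m i)

theorem scalarPairing_zero {d : ℕ} (u : (Fin d → ℤ) → ℂ) :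
    scalarPairing (0 : Laurent d) u = 0 := by
  simp [scalarPairing]

theorem scalarPairing_add {d : ℕ} (p q : Laurent d) (u : (Fin d → ℤ) → ℂ) :
    scalarPairing (p + q) u = scalarPairing p u + scalarPairing q u := by
  simp only [scalarPairing, AddMonoidAlgebra.coeff_add]
  exact Finsupp.sum_add_index' (by simp) (by intros; ring)

/-- Multiplication by `a z^m` is adjoint to `a` times translation by `m`. -/
theorem scalarPairing_single_mul {d : ℕ} (m : Fin d → ℤ) (a : ℂ) (p : Laurent d)
    (u : (Fin d → ℤ) → ℂ) :
    scalarPairing (AddMonoidAlgebra.single m a * p) u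
      = a * scalarPairing p fun k => u (k + m) := by
  induction p using AddMonoidAlgebra.induction_linear with
  | zero => simp [scalarPairing_zero]
  | add p q hp hq => rw [mul_add, scalarPairing_add, scalarPairing_add, hp, hq, mul_add]
  | single n b =>
    rw [AddMonoidAlgebra.single_mul_single, add_comm m n]
    simp only [scalarPairing, AddMonoidAlgebra.coeff_single]
    rw [Finsupp.sum_single_index (by simp), Finsupp.sum_single_index (by simp), mul_assoc]

/-- The annihilator `A^⊥ = {p : ⟨p, u⟩ = 0 for all u ∈ A}` of a shift-invariant subspace `A`,
which is a submodule of the module of `r`-tuples over the ring of Laurent polynomials. -/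
noncomputable def annihilator {d r : ℕ} (A : Submodule ℂ (MultiSeq d r))
    (hA : IsShiftInvariant A) : Submodule (Laurent d) (Fin r → Laurent d) where
  carrier := {p | ∀ u ∈ A, pairing p u = 0}
  zero_mem' := by
    intro u _
    simp [pairing, scalarPairing_zero]
  add_mem' := by
    intro p q hp hq u hu
    have h1 := hp u hu
    have h2 := hq u hu
    simp only [pairing, Pi.add_apply, scalarPairing_add, Finset.sum_add_distrib] at h1 h2 ⊢
    rw [h1, h2, add_zero]
  smul_mem' := by
    intro c p hp
    induction c using AddMonoidAlgebra.induction_linear with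
    | zero =>
      intro u _
      simp [pairing, scalarPairing_zero]
    | add c e hc he =>
      intro u hu
      have h1 := hc u hu
      have h2 := he u hu
      simp only [pairing, Pi.smul_apply, smul_eq_mul, add_mul, scalarPairing_add,
        Finset.sum_add_distrib] at h1 h2 ⊢
      rw [h1, h2, add_zero]
    | single m a =>
      intro u hu
      have h := hp _ (hA.translate_mem m u hu)
      simp only [pairing, Pi.smul_apply, smul_eq_mul, scalarPairing_single_mul] at h ⊢
      rw [← Finset.mul_sum, h, mul_zero]

/-- For a submodule `Q` of `N`, the ideal `{p : multiplication by p is nilpotent on N / Q}`.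
If `Q` is primary, this is the prime ideal `P` for which `Q` is `P`-primary. -/
def primaryIdeal {R N : Type*} [CommRing R] [AddCommGroup N] [Module R N]
    (Q : Submodule R N) : Ideal R :=
  (Q.colon Set.univ).radical

/-- `B = Q_1 ∩ ⋯ ∩ Q_s` is a primary decomposition: each `Q_i` is `P_i`-primary and the primes
`P_i` are distinct. The empty decomposition (`s = 0`) occurs exactly for `B = N`. -/
structure IsPrimaryDecomposition {R N : Type*} [CommRing R] [AddCommGroup N] [Module R N]
    (B : Submodule R N) {s : ℕ} (Q : Fin s → Submodule R N) : Prop where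
  inf_eq : ⨅ i, Q i = B
  primary : ∀ i, (Q i).IsPrimary
  distinct : Function.Injective fun i => primaryIdeal (Q i)

/-- `ω` is a root of the ideal `P`: `p(ω) = 0` for all `p ∈ P`. -/
def IsRoot {d : ℕ} (P : Ideal (Laurent d)) (ω : Fin d → ℂˣ) : Prop :=
  ∀ p ∈ P, laurentEval ω p = 0

end ShiftSynthesis

/-!
Write `L` for the ring of Laurent polynomials. The space `C(ℤ^d; ℂ^r)` is the algebraic dual of
`L^r`, and its product topology is the weak topology of this duality, so a closed shift-invariant
`A` is determined by its annihilator `B` (`mem_topologicalClosure_iff`,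
`mem_iff_forall_annihilator`). Hence `A` is the closed span of its pg-sequences with indices in `Ω`
as soon as every `p ∈ L^r` outside `B` is detected by one of them.

Let `B = ⋂ Q_i` be a primary decomposition, `ω(i)` a root of `P_i`, and `m_i` the maximal ideal of
`ω(i)`. If `p ∉ B`, then `p ∉ Q_i` for some `i`. By Krull's intersection theorem in `L^r / Q_i`
there is `n` with `p ∉ Q_i + m_i^n L^r` (`exists_notMem_sup_pow_smul_top`). Choose a linear
functional on `L^r` that vanishes on `Q_i + m_i^n L^r` but not at `p`. Viewed as a sequence, it
lies in `A` because it annihilates `B ⊆ Q_i`, and it does not annihilate `p`. It is a pg-sequence of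
index `ω(i)` because it annihilates `m_i^n L^r` (`ofFunctional_eq_pgSeq`): modulo `m_i^n` the
variable `z_j` is `ω(i)_j (1 + x_j)` with `x_j` nilpotent, so the binomial series shows that `z^k` is
`ω(i)^k` times a polynomial in `k` with coefficients in `L / m_i^n`.

Primary decompositions exist since `L` is Noetherian, and roots exist by the Nullstellensatz.
-/

namespace ShiftSynthesis

open AddMonoidAlgebra

/-! ### Finite binomial series of unipotent elements -/

/-- Pascal's rule for truncated binomial series: passing from `a` to `a + 1` multiplies the series
of `(1 + x) ^ a` by `1 + x`, up to a multiple of `x ^ (n + 1)`. -/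
theorem sum_choose_add_one {S : Type*} [CommRing S] [Algebra ℂ S] (a : ℂ) (x : S) (n : ℕ) :
    ∑ j ∈ Finset.range (n + 1), Ring.choose (a + 1) j • x ^ j
      = (x + 1) * ∑ j ∈ Finset.range (n + 1), Ring.choose a j • x ^ j
        - Ring.choose a n • x ^ (n + 1) := by
  induction n with
  | zero => simp
  | succ n ih =>
    rw [Finset.sum_range_succ, ih, Finset.sum_range_succ _ (n + 1), Ring.choose_succ_succ]
    simp only [Algebra.smul_def, map_add]
    ring

/-- If `y - 1` is nilpotent, the integer powers of `y` are given by the finite binomial series. They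
appear here as a function `g` with `g 0 = 1` and `g (a + 1) = y * g a`, which determines `g` on the
negative integers too because `y` is a unit. -/
theorem eq_sum_choose_of_pow_eq_zero {S : Type*} [CommRing S] [Algebra ℂ S] {y : S} {n : ℕ}
    (hy : (y - 1) ^ n = 0) {g : ℤ → S} (h0 : g 0 = 1) (hg : ∀ a, g (a + 1) = y * g a) (a : ℤ) :
    g a = ∑ j ∈ Finset.range (n + 1), Ring.choose (a : ℂ) j • (y - 1) ^ j := by
  have hunit : IsUnit y := by
    have h : IsNilpotent (y - 1) := ⟨n, hy⟩
    simpa using h.isUnit_one_add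
  have hstep : ∀ b : ℂ, ∑ j ∈ Finset.range (n + 1), Ring.choose (b + 1) j • (y - 1) ^ j
      = y * ∑ j ∈ Finset.range (n + 1), Ring.choose b j • (y - 1) ^ j := by
    intro b
    rw [sum_choose_add_one, pow_succ, hy]
    simp
  induction a using Int.induction_on with
  | zero =>
    rw [h0, Finset.sum_range_succ']
    simp [Ring.choose_zero_succ]
  | succ k ih => rw [hg, ih]; push_cast; rw [hstep]
  | pred k ih =>
    refine hunit.mul_left_cancel ?_
    rw [← hg, ← hstep]
    convert ih using 1 <;> simp

/-! ### Laurent monomials near a point of the torus -/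

/-- Evaluation of Laurent polynomials at `ω`, as a homomorphism of algebras. Its kernel is the
maximal ideal of the point `ω`. -/
noncomputable def laurentEvalHom {d : ℕ} (ω : Fin d → ℂˣ) : Laurent d →ₐ[ℂ] ℂ :=
  AddMonoidAlgebra.lift ℂ ℂ (Fin d → ℤ)
    { toFun := fun k => monomialValue ω k.toAdd
      map_one' := by simp [monomialValue]
      map_mul' := fun a b => by
        simp [monomialValue, zpow_add₀, Finset.prod_mul_distrib] }

theorem laurentEvalHom_apply {d : ℕ} (ω : Fin d → ℂˣ) (p : Laurent d) :
    laurentEvalHom ω p = laurentEval ω p := by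
  rw [laurentEvalHom, AddMonoidAlgebra.lift_apply]
  rfl

/-- The scaled coordinate `ω_i⁻¹ z_i`, which takes the value `1` at `ω`. -/
noncomputable def scaledVar {d : ℕ} (ω : Fin d → ℂˣ) (i : Fin d) : Laurent d :=
  single (Pi.single i 1) (ω i : ℂ)⁻¹

theorem scaledVar_sub_one_mem {d : ℕ} (ω : Fin d → ℂˣ) (i : Fin d) :
    scaledVar ω i - 1 ∈ RingHom.ker (laurentEvalHom ω) := by
  rw [RingHom.mem_ker, map_sub, map_one, laurentEvalHom_apply, sub_eq_zero]
  simp only [laurentEval, scalarPairing, scaledVar, coeff_single]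
  rw [Finsupp.sum_single_index (by simp)]
  have : monomialValue ω (Pi.single i 1) = ω i := by
    rw [monomialValue, Finset.prod_eq_single i (by intro j _ hj; simp [hj]) (by simp)]
    simp
  rw [this]; simp

/-- In an algebra in which each `ω_i⁻¹ z_i - 1` is nilpotent, `z^k` is `ω^k` times a product of
finite binomial series in these elements, for all `k ∈ ℤ^d`. -/
theorem map_monomial_eq {d : ℕ} (ω : Fin d → ℂˣ) {S : Type*} [CommRing S] [Algebra ℂ S]
    (π : Laurent d →ₐ[ℂ] S) {n : ℕ} (h : ∀ i, (π (scaledVar ω i) - 1) ^ n = 0) (k : Fin d → ℤ) :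
    π (single k 1) = monomialValue ω k • ∏ i, ∑ j ∈ Finset.range (n + 1),
      Ring.choose (k i : ℂ) j • (π (scaledVar ω i) - 1) ^ j := by
  have key : ∀ i (a : ℤ), π (single (Pi.single i a) ((ω i : ℂ) ^ (-a))) =
      ∑ j ∈ Finset.range (n + 1), Ring.choose (a : ℂ) j • (π (scaledVar ω i) - 1) ^ j := by
    intro i
    refine eq_sum_choose_of_pow_eq_zero (h i) ?_ ?_
    · rw [Pi.single_zero, neg_zero, zpow_zero, ← one_def, map_one]
    · intro a
      rw [← map_mul, scaledVar, single_mul_single, ← Pi.single_add, add_comm 1 a, neg_add,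
        zpow_add₀ (ω i).ne_zero, zpow_neg_one, mul_comm]
  simp_rw [← key]
  rw [← map_prod, ← map_smul]
  congr 1
  have hprod : ∀ (s : Finset (Fin d)) (f : Fin d → Fin d → ℤ) (c : Fin d → ℂ),
      ∏ i ∈ s, (single (f i) (c i) : Laurent d) = single (∑ i ∈ s, f i) (∏ i ∈ s, c i) := by
    intro s f c
    induction s using Finset.induction_on with
    | empty => simp [one_def]
    | insert i s hi ih => simp [Finset.prod_insert hi, Finset.sum_insert hi, ih, single_mul_single]
  rw [hprod, Finset.univ_sum_single, smul_single, smul_eq_mul, monomialValue,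
    ← Finset.prod_mul_distrib, Finset.prod_eq_one]
  intro i _
  rw [← zpow_add₀ (ω i).ne_zero]
  simp

/-! ### Functionals and pg-sequences -/

theorem exists_eval_eq_choose {d : ℕ} (i : Fin d) (j : ℕ) :
    ∃ b : MvPolynomial (Fin d) ℂ, ∀ v : Fin d → ℂ, MvPolynomial.eval v b = Ring.choose (v i) j := by
  refine ⟨MvPolynomial.C ((j.factorial : ℂ)⁻¹) *
    Polynomial.aeval (MvPolynomial.X i) (descPochhammer ℂ j), fun v => ?_⟩
  rw [Ring.choose_eq_smul, map_mul, MvPolynomial.eval_C, smul_eq_mul]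
  congr 1
  have h := Polynomial.aeval_algHom_apply (MvPolynomial.aeval (R := ℂ) v)
    (MvPolynomial.X i) (descPochhammer ℂ j)
  rw [MvPolynomial.aeval_X, MvPolynomial.aeval_eq_eval] at h
  refine h.symm.trans ?_
  rw [← descPochhammer_map (algebraMap ℤ ℂ), Polynomial.aeval_map_algebraMap,
    Polynomial.aeval_eq_smeval]

/-- A linear functional that vanishes on the `n`-th power of the maximal ideal of `ω` takes values
`ω^k h(k)` on the monomials `z^k`, with `h` a polynomial. -/
theorem exists_polynomial_of_pow_le_ker {d : ℕ} (ω : Fin d → ℂˣ) (n : ℕ)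
    (φ : Laurent d →ₗ[ℂ] ℂ) (hφ : ∀ x ∈ RingHom.ker (laurentEvalHom ω) ^ n, φ x = 0) :
    ∃ h : MvPolynomial (Fin d) ℂ, ∀ k : Fin d → ℤ,
      φ (single k 1) = monomialValue ω k * MvPolynomial.eval (fun i => (k i : ℂ)) h := by
  classical
  set I := RingHom.ker (laurentEvalHom ω) ^ n with hI
  let ψ : (Laurent d ⧸ I) →ₗ[ℂ] ℂ := ((I.restrictScalars ℂ).liftQ φ hφ) ∘ₗ
    (Submodule.Quotient.restrictScalarsEquiv ℂ I).symm.toLinearMap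
  have hψ : ∀ x, φ x = ψ (Ideal.Quotient.mkₐ ℂ I x) := fun x => rfl
  have hnil : ∀ i, (Ideal.Quotient.mkₐ ℂ I (scaledVar ω i) - 1) ^ n = 0 := by
    intro i
    rw [← map_one (Ideal.Quotient.mkₐ ℂ I), ← map_sub, ← map_pow]
    exact Ideal.Quotient.eq_zero_iff_mem.2 (Ideal.pow_mem_pow (scaledVar_sub_one_mem ω i) n)
  choose b hb using exists_eval_eq_choose (d := d)
  refine ⟨∑ α ∈ Fintype.piFinset fun _ : Fin d => Finset.range (n + 1), (∏ i, b i (α i)) *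
    MvPolynomial.C (ψ (∏ i, (Ideal.Quotient.mkₐ ℂ I (scaledVar ω i) - 1) ^ α i)), fun k => ?_⟩
  rw [hψ, map_monomial_eq ω _ hnil, map_smul, smul_eq_mul, Finset.prod_univ_sum, map_sum, map_sum]
  congr 1
  refine Finset.sum_congr rfl fun α _ => ?_
  simp only [map_mul, map_prod, MvPolynomial.eval_C, hb]
  rw [Finset.prod_smul, map_smul, smul_eq_mul]

/-- The function `u : ℤ^d → ℂ^r` that represents a linear functional on `L^r`. -/
noncomputable def ofFunctional {d r : ℕ} (φ : (Fin r → Laurent d) →ₗ[ℂ] ℂ) : MultiSeq d r :=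
  fun k t => φ (Pi.single t (single k 1))

theorem pairing_ofFunctional {d r : ℕ} (φ : (Fin r → Laurent d) →ₗ[ℂ] ℂ)
    (p : Fin r → Laurent d) : pairing p (ofFunctional φ) = φ p := by
  have h : ∀ (t : Fin r) (q : Laurent d),
      scalarPairing q (fun k => ofFunctional φ k t) = φ (Pi.single t q) := by
    intro t q
    induction q using AddMonoidAlgebra.induction_linear with
    | zero => simp [scalarPairing_zero]
    | add p q hp hq => rw [scalarPairing_add, hp, hq, Pi.single_add, map_add]
    | single k a =>
      rw [scalarPairing, coeff_single, Finsupp.sum_single_index (by simp), ofFunctional,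
        ← smul_eq_mul, ← map_smul, ← Pi.single_smul, smul_single, smul_eq_mul, mul_one]
  rw [pairing]
  simp_rw [h]
  rw [← map_sum, Finset.univ_sum_single]

theorem ofFunctional_eq_pgSeq {d r : ℕ} (ω : Fin d → ℂˣ) (n : ℕ)
    (φ : (Fin r → Laurent d) →ₗ[ℂ] ℂ)
    (hφ : ∀ x ∈ RingHom.ker (laurentEvalHom ω) ^ n •
      (⊤ : Submodule (Laurent d) (Fin r → Laurent d)), φ x = 0) :
    ∃ h, ofFunctional φ = pgSeq ω h := by
  have key := fun t => exists_polynomial_of_pow_le_ker ω n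
    (φ ∘ₗ LinearMap.single ℂ (fun _ => Laurent d) t) fun x hx => hφ _ <| by
      have : (Pi.single t x : Fin r → Laurent d) = x • Pi.single t 1 := by
        rw [← Pi.single_smul, smul_eq_mul, mul_one]
      rw [LinearMap.single_apply, this]
      exact Submodule.smul_mem_smul hx trivial
  choose h hh using key
  refine ⟨h, ?_⟩
  ext k t
  exact hh t k

/-! ### Duality between closed subspaces and annihilators -/

theorem continuous_pairing {d r : ℕ} (p : Fin r → Laurent d) :
    Continuous fun u : MultiSeq d r => pairing p u := by
  unfold pairing scalarPairing Finsupp.sum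
  fun_prop

/-- Hahn-Banach for the topology of coordinatewise convergence: a point lies in the closure of a
subspace if and only if it is killed by every vector of Laurent polynomials that kills the
subspace. -/
theorem mem_topologicalClosure_iff {d r : ℕ} (V : Submodule ℂ (MultiSeq d r)) (u : MultiSeq d r) :
    u ∈ V.topologicalClosure ↔
      ∀ p : Fin r → Laurent d, (∀ v ∈ V, pairing p v = 0) → pairing p u = 0 := by
  classical
  refine ⟨fun hu p hp => ?_, fun h => ?_⟩
  · have hcl : IsClosed {v : MultiSeq d r | pairing p v = 0} :=
      isClosed_singleton.preimage (continuous_pairing p)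
    exact closure_minimal (fun v hv => hp v hv) hcl hu
  -- A basic neighbourhood of `u` constrains only the coordinates in a finite set `F`.
  have hF : ∀ F : Finset (Fin d → ℤ), ∃ v ∈ V, ∀ k ∈ F, v k = u k := by
    intro F
    let π : MultiSeq d r →ₗ[ℂ] (F → Fin r → ℂ) := LinearMap.funLeft ℂ (Fin r → ℂ) Subtype.val
    by_contra! hcon
    have hnot : π u ∉ V.map π := by
      rintro ⟨v, hv, hvu⟩
      obtain ⟨k, hk, hne⟩ := hcon v hv
      exact hne (congrFun hvu ⟨k, hk⟩)
    obtain ⟨g, hg, hker⟩ := Submodule.exists_le_ker_of_notMem hnot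
    -- The functional `g` on the coordinates in `F` is the pairing with a vector supported in `F`.
    have hrep : ∀ w : MultiSeq d r, pairing (fun t => ∑ k : F,
        (single k.1 (g (Pi.single k (Pi.single t 1))) : Laurent d)) w = g (π w) := by
      intro w
      have hs : ∀ t : Fin r, scalarPairing (∑ k : F,
          (single k.1 (g (Pi.single k (Pi.single t 1))) : Laurent d)) (fun k => w k t)
          = ∑ k : F, g (Pi.single k (Pi.single t 1)) * w k.1 t := by
        intro t
        refine (map_sum (AddMonoidHom.mk' (fun q : Laurent d => scalarPairing q fun k => w k t)
          fun p q => scalarPairing_add p q _) _ _).trans (Finset.sum_congr rfl fun k _ => ?_)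
        simp [scalarPairing]
      simp only [pairing, hs]
      have hw : π w = ∑ k : F, ∑ t, w k.1 t • Pi.single k (Pi.single t 1) := by
        ext k t
        rw [Finset.sum_apply, Finset.sum_apply, Finset.sum_eq_single k, Finset.sum_apply,
          Finset.sum_apply, Finset.sum_eq_single t]
        · simp [π, LinearMap.funLeft_apply]
        · intro t' _ ht
          simp [Pi.single_eq_of_ne ht.symm]
        · simp
        · intro k' _ hk
          simp [Finset.sum_apply, Pi.single_eq_of_ne hk.symm]
        · simp
      rw [hw, Finset.sum_comm]
      simp [mul_comm]
    refine hg ?_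
    rw [← hrep]
    refine h _ fun v hv => ?_
    rw [hrep]
    exact hker (Submodule.mem_map_of_mem hv)
  change u ∈ closure (V : Set (MultiSeq d r))
  rw [mem_closure_iff_nhds]
  intro s hs
  rw [nhds_pi, Filter.mem_pi] at hs
  obtain ⟨I, hI, U, hU, hsub⟩ := hs
  obtain ⟨v, hv, hvu⟩ := hF hI.toFinset
  refine ⟨v, hsub fun k hk => ?_, hv⟩
  rw [hvu k (hI.mem_toFinset.2 hk)]
  exact mem_of_mem_nhds (hU k)

theorem mem_iff_forall_annihilator {d r : ℕ} {A : Submodule ℂ (MultiSeq d r)}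
    (hA : IsShiftInvariant A) (hclosed : IsClosed (A : Set (MultiSeq d r))) (u : MultiSeq d r) :
    u ∈ A ↔ ∀ p ∈ annihilator A hA, pairing p u = 0 := by
  conv_lhs => rw [← hclosed.submodule_topologicalClosure_eq]
  exact mem_topologicalClosure_iff A u

/-! ### Primary submodules, roots and primary decompositions -/

/-- A consequence of Krull's intersection theorem: a primary submodule whose prime lies in a proper
ideal `m` is closed in the `m`-adic topology. -/
theorem exists_notMem_sup_pow_smul_top {R M : Type*} [CommRing R] [IsNoetherianRing R]
    [AddCommGroup M] [Module R M] [Module.Finite R M] {Q : Submodule R M} (hQ : Q.IsPrimary)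
    {m : Ideal R} (hm : m ≠ ⊤) (hle : primaryIdeal Q ≤ m) {x : M} (hx : x ∉ Q) :
    ∃ n : ℕ, x ∉ Q ⊔ m ^ n • (⊤ : Submodule R M) := by
  by_contra! hcon
  have hmem : Q.mkQ x ∈ (⨅ n : ℕ, m ^ n • ⊤ : Submodule R (M ⧸ Q)) := by
    rw [Submodule.mem_iInf]
    intro n
    have h := Submodule.mem_map_of_mem (f := Q.mkQ) (hcon n)
    rw [Submodule.map_sup, Submodule.map_smul'', Submodule.map_top, Submodule.range_mkQ,
      Submodule.mkQ_map_self, bot_sup_eq] at h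
    exact h
  obtain ⟨a, ha⟩ := (m.mem_iInf_smul_pow_eq_bot_iff _).1 hmem
  -- `1 - a` kills the class of `x`, so it acts nilpotently, so it lies in `m` together with `a`.
  have hmul : (1 - a.1) • x ∈ Q := by
    rw [← Submodule.Quotient.mk_eq_zero, Submodule.Quotient.mk_smul, sub_smul, one_smul,
      sub_eq_zero]
    exact ha.symm
  have hin : 1 - a.1 ∈ m := hle ((hQ.mem_or_mem hmul).resolve_left hx)
  refine hm ((Ideal.eq_top_iff_one m).2 ?_)
  simpa using m.add_mem hin a.2

theorem primaryIdeal_ne_top {R N : Type*} [CommRing R] [AddCommGroup N] [Module R N]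
    {Q : Submodule R N} (hQ : Q.IsPrimary) : primaryIdeal Q ≠ ⊤ :=
  hQ.isPrime_radical_colon.ne_top

/-- A form of the Nullstellensatz for the torus `(ℂ \ {0})^d`. -/
theorem exists_root {d : ℕ} {P : Ideal (Laurent d)} (hP : P ≠ ⊤) : ∃ ω, IsRoot P ω := by
  obtain ⟨m, hm, hPm⟩ := P.exists_le_maximal hP
  let := Ideal.Quotient.field m
  have hfin : Module.Finite ℂ (Laurent d ⧸ m) :=
    finite_of_finite_type_of_isJacobsonRing ℂ (Laurent d ⧸ m)
  have hbij : Function.Bijective (algebraMap ℂ (Laurent d ⧸ m)) :=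
    IsAlgClosed.algebraMap_bijective_of_isIntegral
  let e : ℂ ≃ₐ[ℂ] (Laurent d ⧸ m) := AlgEquiv.ofBijective (Algebra.ofId ℂ _) hbij
  let f : Laurent d →ₐ[ℂ] ℂ := e.symm.toAlgHom.comp (Ideal.Quotient.mkₐ ℂ m)
  let ω : Fin d → ℂˣ := fun i =>
    { val := f (single (Pi.single i 1) 1)
      inv := f (single (Pi.single i (-1)) 1)
      val_inv := by
        rw [← map_mul, single_mul_single, ← Pi.single_add]; simp [← one_def]
      inv_val := by
        rw [← map_mul, single_mul_single, ← Pi.single_add]; simp [← one_def] }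
  have hf : f = laurentEvalHom ω := by
    -- Both maps send each `ω_i⁻¹ z_i` to `1`, so `map_monomial_eq` gives them equal values on `z^k`.
    have hone : ∀ i, f (scaledVar ω i) = 1 := by
      intro i
      have : scaledVar ω i = (ω i : ℂ)⁻¹ • single (Pi.single i 1) 1 := by simp [scaledVar]
      rw [this, map_smul, smul_eq_mul]
      exact inv_mul_cancel₀ (ω i).ne_zero
    have hone' : ∀ i, laurentEvalHom ω (scaledVar ω i) = 1 := by
      intro i
      simpa [sub_eq_zero] using scaledVar_sub_one_mem ω i
    refine AddMonoidAlgebra.algHom_ext (fun k => ?_) (by ext)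
    rw [map_monomial_eq ω f (n := 1) (by simp [hone]),
      map_monomial_eq ω (laurentEvalHom ω) (n := 1) (by simp [hone'])]
    simp_rw [hone, hone']
  refine ⟨ω, fun p hp => ?_⟩
  rw [← laurentEvalHom_apply, ← hf]
  have : Ideal.Quotient.mkₐ ℂ m p = 0 := Ideal.Quotient.eq_zero_iff_mem.2 (hPm hp)
  simp only [f, AlgHom.comp_apply, this, map_zero]

instance {d : ℕ} : IsNoetherianRing (Laurent d) :=
  Algebra.FiniteType.isNoetherianRing ℂ _

theorem exists_isPrimaryDecomposition {R N : Type*} [CommRing R] [IsNoetherianRing R]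
    [AddCommGroup N] [Module R N] [Module.Finite R N] (B : Submodule R N) :
    ∃ (s : ℕ) (Q : Fin s → Submodule R N), IsPrimaryDecomposition B Q := by
  obtain ⟨t, ht⟩ :=
    Submodule.IsLasker.exists_isMinimalPrimaryDecomposition (Submodule.isLasker R N) B
  refine ⟨t.card, fun i => (t.equivFin.symm i).1, ?_, fun i => ht.primary (t.equivFin.symm i).2, ?_⟩
  · rw [t.equivFin.symm.iInf_comp (g := fun q : t => q.1), ← ht.inf_eq, Finset.inf_eq_iInf,
      iInf_subtype]
    rfl
  · intro i j hij
    by_contra hne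
    exact ht.distinct (t.equivFin.symm i).2 (t.equivFin.symm j).2
      (fun h => hne (t.equivFin.symm.injective (Subtype.ext h))) hij

/-! ### Closed spans of pg-sequences -/

theorem closedPgSpan_mono {d r : ℕ} (A : Submodule ℂ (MultiSeq d r)) {Ω Ω' : Set (Fin d → ℂˣ)}
    (h : Ω ⊆ Ω') : closedPgSpan A Ω ≤ closedPgSpan A Ω' :=
  Submodule.topologicalClosure_mono <| Submodule.span_mono fun _ ⟨hu, ω, hω, hh⟩ =>
    ⟨hu, ω, h hω, hh⟩

theorem closedPgSpan_le {d r : ℕ} {A : Submodule ℂ (MultiSeq d r)}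
    (hclosed : IsClosed (A : Set (MultiSeq d r))) (Ω : Set (Fin d → ℂˣ)) :
    closedPgSpan A Ω ≤ A :=
  Submodule.topologicalClosure_minimal _ (Submodule.span_le.2 fun _ hu => hu.1) hclosed

/-- The roots of the primes of a primary decomposition suffice as geometric indices. -/
theorem eq_closedPgSpan_range {d r : ℕ} {A : Submodule ℂ (MultiSeq d r)}
    (hA : IsShiftInvariant A) (hclosed : IsClosed (A : Set (MultiSeq d r))) {s : ℕ}
    {Q : Fin s → Submodule (Laurent d) (Fin r → Laurent d)}
    (hQ : IsPrimaryDecomposition (annihilator A hA) Q) {ω : Fin s → Fin d → ℂˣ}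
    (hω : ∀ i, IsRoot (primaryIdeal (Q i)) (ω i)) : A = closedPgSpan A (Set.range ω) := by
  refine le_antisymm (fun u hu => ?_) (closedPgSpan_le hclosed _)
  refine (mem_topologicalClosure_iff _ u).2 fun p hp => ?_
  suffices hpB : p ∈ annihilator A hA from hpB u hu
  rw [← hQ.inf_eq, Submodule.mem_iInf]
  intro i
  by_contra hpi
  set m := RingHom.ker (laurentEvalHom (ω i))
  have hle : primaryIdeal (Q i) ≤ m := fun q hq => by
    rw [RingHom.mem_ker, laurentEvalHom_apply]
    exact hω i q hq
  obtain ⟨n, hn⟩ := exists_notMem_sup_pow_smul_top (hQ.primary i)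
    (RingHom.ker_ne_top (laurentEvalHom (ω i))) hle hpi
  -- This functional is nonzero at `p`, yet as a sequence it is one of those that `p` annihilates.
  obtain ⟨φ, hφp, hφ⟩ := Submodule.exists_le_ker_of_notMem
    (p := (Q i ⊔ m ^ n • ⊤).restrictScalars ℂ) (v := p) hn
  obtain ⟨h, hpg⟩ := ofFunctional_eq_pgSeq (ω i) n φ fun x hx =>
    hφ ((le_sup_right : _ ≤ Q i ⊔ m ^ n • ⊤) hx)
  have hmem : ofFunctional φ ∈ A := by
    rw [mem_iff_forall_annihilator hA hclosed]
    intro q hq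
    rw [← hQ.inf_eq] at hq
    rw [pairing_ofFunctional]
    exact hφ ((le_sup_left : _ ≤ Q i ⊔ m ^ n • ⊤) (iInf_le Q i hq))
  refine hφp ?_
  rw [← pairing_ofFunctional]
  exact hp _ (Submodule.subset_span ⟨hmem, ω i, ⟨i, rfl⟩, h, hpg⟩)

end ShiftSynthesis

open ShiftSynthesis

theorem theorem4p10 {d r : ℕ}
    (A : Submodule ℂ (ShiftSynthesis.MultiSeq d r))
    (hA : ShiftSynthesis.IsShiftInvariant A)
    (hclosed : IsClosed (A : Set (ShiftSynthesis.MultiSeq d r))) :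
    -- `A` is the closed linear span of the pg-sequences it contains
    A = ShiftSynthesis.closedPgSpan A Set.univ ∧
    -- finitely many geometric indices suffice
    (∃ Ω : Finset (Fin d → ℂˣ), A = ShiftSynthesis.closedPgSpan A (Ω : Set (Fin d → ℂˣ))) ∧
    -- the annihilator module of `A` has a primary decomposition
    (∃ (s : ℕ) (Q : Fin s → Submodule (ShiftSynthesis.Laurent d)
        (Fin r → ShiftSynthesis.Laurent d)),
      ShiftSynthesis.IsPrimaryDecomposition (ShiftSynthesis.annihilator A hA) Q) ∧
    -- for every primary decomposition, each component has a root, and any choice of one root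
    -- for each component gives a sufficient set of geometric indices
    (∀ (s : ℕ) (Q : Fin s → Submodule (ShiftSynthesis.Laurent d)
        (Fin r → ShiftSynthesis.Laurent d)),
      ShiftSynthesis.IsPrimaryDecomposition (ShiftSynthesis.annihilator A hA) Q →
        (∀ i, ∃ ω, ShiftSynthesis.IsRoot (ShiftSynthesis.primaryIdeal (Q i)) ω) ∧
        ∀ ω : Fin s → Fin d → ℂˣ,
          (∀ i, ShiftSynthesis.IsRoot (ShiftSynthesis.primaryIdeal (Q i)) (ω i)) →
            A = ShiftSynthesis.closedPgSpan A (Set.range ω)) := by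
  have main : ∀ (s : ℕ) (Q : Fin s → Submodule (Laurent d) (Fin r → Laurent d)),
      IsPrimaryDecomposition (annihilator A hA) Q →
        (∀ i, ∃ ω, IsRoot (primaryIdeal (Q i)) ω) ∧
        ∀ ω : Fin s → Fin d → ℂˣ, (∀ i, IsRoot (primaryIdeal (Q i)) (ω i)) →
          A = closedPgSpan A (Set.range ω) := fun s Q hQ =>
    ⟨fun i => exists_root (primaryIdeal_ne_top (hQ.primary i)),
      fun ω hω => eq_closedPgSpan_range hA hclosed hQ hω⟩
  obtain ⟨s, Q, hQ⟩ := exists_isPrimaryDecomposition (annihilator A hA)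
  choose ω hω using (main s Q hQ).1
  have hAω := (main s Q hQ).2 ω hω
  refine ⟨le_antisymm ?_ (closedPgSpan_le hclosed _), ⟨(Set.finite_range ω).toFinset, ?_⟩,
    ⟨s, Q, hQ⟩, main⟩
  · exact hAω.le.trans (closedPgSpan_mono A (Set.subset_univ _))
  · rwa [Set.Finite.coe_toFinset]
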